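/- **Theorem 2 (catalytic dephasing).** All Hilbert spaces are finite-dimensional. Let $\sigma$ be a quantum state (a positive semidefinite operator of trace one) on a Hilbert space $B$, and let $S_{\min}(\sigma) = -\log_2\|\sigma\|$ be its min-entropy, where $\|\cdot\|$ is the operator norm. Say that $\sigma$ *can dephase $n$-dimensional quantum states, leaving $\tau$*, if there are an orthonormal basis $\{|i\rangle\}$ of $A=\mathbb{C}^n$, a quantum state $\eta$ on a space $A'$, a quantum state $\tau$ on a space $B'$, and an isometry $U : A\otimes B \to (A\otimes A')\otimes B'$ such that for every quantum state $\rho$ on $A$ $$\operatorname{Tr}_{B'}\left[U(\rho\otimes\sigma)U^\dagger\right] = \sum_i \langle i|\rho|i\rangle\,|i\rangle\langle i| \otimes \eta \qquad\text{and}\qquad \operatorname{Tr}_{AA'}\left[U(\rho\otimes\sigma)U^\dagger\right] = \tau .$$ Say that $\sigma$ *can dephase $n$-dimensional quantum states catalytically* if this is possible so that the state $\tau$ left behind can again be used in the same way, and so on indefinitely; that is, if there is an infinite sequence of quantum states $\sigma=\sigma_0,\sigma_1,\sigma_2,\dots$ such that, for every $k$, $\sigma_k$ can dephase $n$-dimensional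 quantum states, leaving $\sigma_{k+1}$. Let $d\ge 1$ be an integer. Then $\sigma$ can dephase $d^2$-dimensional quantum states catalytically if and only if $S_{\min}(\sigma)\ge\log_2 d$. -/

import Mathlib

open scoped Kronecker Matrix ComplexOrder

/-- A quantum state on the finite-dimensional Hilbert space `ℂ^dim`, as a density matrix. -/
structure QState where
  dim : ℕ
  mat : Matrix (Fin dim) (Fin dim) ℂ
  posSemidef : mat.PosSemidef
  trace_eq_one : mat.trace = 1

/-- The min-entropy `-log₂ ‖σ‖`, with the operator norm on the Euclidean space `ℂ^dim`. -/
noncomputable def QState.minEntropy (σ : QState) : ℝ :=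
  - Real.logb 2 ‖Matrix.toEuclideanCLM (n := Fin σ.dim) (𝕜 := ℂ) σ.mat‖

/-- Partial trace over the first tensor factor. -/
def partialTraceLeft {α β : Type*} [Fintype α]
    (M : Matrix (α × β) (α × β) ℂ) : Matrix β β ℂ :=
  fun i j => ∑ k, M (k, i) (k, j)

/-- Partial trace over the second tensor factor. -/
def partialTraceRight {α β : Type*} [Fintype β]
    (M : Matrix (α × β) (α × β) ℂ) : Matrix α α ℂ :=
  fun i j => ∑ k, M (i, k) (j, k)

/-- The completely dephased matrix `∑ᵢ ⟨eᵢ|ρ|eᵢ⟩ |eᵢ⟩⟨eᵢ|` for an orthonormal basis `e`. -/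
noncomputable def dephased {n : ℕ}
    (e : OrthonormalBasis (Fin n) ℂ (EuclideanSpace ℂ (Fin n)))
    (ρ : Matrix (Fin n) (Fin n) ℂ) : Matrix (Fin n) (Fin n) ℂ :=
  ∑ i, (star (e i).ofLp ⬝ᵥ (ρ *ᵥ (e i).ofLp)) •
    Matrix.vecMulVec (e i).ofLp (star (e i).ofLp)

/-- The source `σ` is used, through the isometry `U`, to dephase `n`-dimensional states exactly with
respect to the basis `e`. The output of `U` is `(A ⊗ A') ⊗ B'`: the `A ⊗ A'` marginal is the
dephased input in a product with the leftover source `η`, and the `B'` marginal is `τ`,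
both for every input state `ρ`. -/
structure IsDephasing {n : ℕ} (e : OrthonormalBasis (Fin n) ℂ (EuclideanSpace ℂ (Fin n)))
    (σ η τ : QState)
    (U : Matrix ((Fin n × Fin η.dim) × Fin τ.dim) (Fin n × Fin σ.dim) ℂ) : Prop where
  isometry : Uᴴ * U = 1
  output : ∀ ρ : Matrix (Fin n) (Fin n) ℂ, ρ.PosSemidef → ρ.trace = 1 →
    partialTraceRight (U * (ρ ⊗ₖ σ.mat) * Uᴴ) = dephased e ρ ⊗ₖ η.mat
  complement : ∀ ρ : Matrix (Fin n) (Fin n) ℂ, ρ.PosSemidef → ρ.trace = 1 →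
    partialTraceLeft (U * (ρ ⊗ₖ σ.mat) * Uᴴ) = τ.mat

/-- The source `σ` can dephase `n`-dimensional states with respect to some orthonormal basis, and is
thereby turned into `τ`. -/
def DephasesInto (n : ℕ) (σ τ : QState) : Prop :=
  ∃ (e : OrthonormalBasis (Fin n) ℂ (EuclideanSpace ℂ (Fin n))) (η : QState)
    (U : Matrix ((Fin n × Fin η.dim) × Fin τ.dim) (Fin n × Fin σ.dim) ℂ),
    IsDephasing e σ η τ U

/-- The source `σ` can dephase `n`-dimensional states catalytically: it can do so in such a way that
the resulting source can again do so catalytically, and so on without end. This recursive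
requirement is unfolded into an infinite sequence of sources, the first of which is `σ`. -/
def CatalyticallyDephases (n : ℕ) (σ : QState) : Prop :=
  ∃ s : ℕ → QState, s 0 = σ ∧ ∀ k, DephasesInto n (s k) (s (k + 1))

/-! Both directions go through the eigenvalues of `σ`: the entropy condition says that each is at
most `1/d`.

Necessity already follows from one dephasing step, which forces `n λ² ≤ 1` for every eigenvalue `λ`
of `σ` (`card_mul_sq_le_one_of_dephasing`). In eigenbases, dephasing makes the purified blocks `w
(j, k)` orthogonal with squared norms `p k`, the eigenvalues of `η`. Bessel's inequality bounds
their total overlap with `τ ⊗ |b₀⟩⟨b₀|` by its trace, which is 1. Since `τ` does not depend on the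
input, it can be computed from the input `j` when estimating the overlap of `w (j, k)`; with
Cauchy–Schwarz over `k`, each `j` contributes at least `λ²`, where `λ` is the eigenvalue at `b₀`.

For sufficiency, weights at most `1/d` are a mixture of uniform distributions on `d`-element sets
`S` of eigenvectors (`exists_weights_card_eq`). The isometry writes `S` coherently into both `A'`
and `B'` and, controlled on the input, applies one of the `d²` Weyl unitaries on `S`. Their trace
orthogonality removes the coherences of the input (`exists_weyl_system`). The state left behind has
eigenvalues 0 or `p S / d`, again at most `1/d`, so the procedure can be iterated forever. -/

/-! ### Eigenvalue bound from a single dephasing step. -/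

theorem sum_norm_inner_sq_div_le_of_pairwise_orthogonal {ι E : Type*} [Fintype ι]
    [NormedAddCommGroup E] [InnerProductSpace ℂ E] (w : ι → E)
    (hw : ∀ i j, i ≠ j → inner ℂ (w i) (w j) = 0) (t : E) :
    ∑ i, ‖inner ℂ (w i) t‖ ^ 2 / ‖w i‖ ^ 2 ≤ ‖t‖ ^ 2 := by
  classical
  have ho : Orthonormal ℂ (fun i : {i // w i ≠ 0} => ((‖w i‖⁻¹ : ℝ) : ℂ) • w i) := by
    refine ⟨fun i => ?_, fun i j hij => ?_⟩
    · have h : ‖w i‖ ≠ 0 := norm_ne_zero_iff.mpr i.2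
      simp [norm_smul, h]
    · simp only [inner_smul_left, inner_smul_right]
      rw [hw _ _ (fun h => hij (Subtype.ext h))]
      simp
  have hb := ho.sum_inner_products_le (s := Finset.univ) t
  refine le_trans (le_of_eq ?_) hb
  -- Zero vectors cannot be normalized, but their terms vanish because `x / 0 = 0`.
  have h0 : ∑ i, ‖inner ℂ (w i) t‖ ^ 2 / ‖w i‖ ^ 2
      = ∑ i ∈ Finset.univ.filter (fun i => w i ≠ 0), ‖inner ℂ (w i) t‖ ^ 2 / ‖w i‖ ^ 2 := by
    rw [Finset.sum_filter]
    refine Finset.sum_congr rfl fun i _ => ?_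
    split_ifs with h
    · rfl
    · simp [not_not.mp h]
  rw [h0, Finset.sum_subtype (p := fun i => w i ≠ 0) _ (by simp)]
  refine Finset.sum_congr rfl fun i _ => ?_
  simp only [inner_smul_left, norm_mul]
  simp [mul_pow, div_eq_inv_mul]

theorem sq_sum_le_sum_sq_div_mul_sum {κ : Type*} [Fintype κ] (g p : κ → ℝ)
    (hp : ∀ k, 0 ≤ p k) (hg : ∀ k, p k = 0 → g k = 0) :
    (∑ k, g k) ^ 2 ≤ (∑ k, g k ^ 2 / p k) * ∑ k, p k := by
  refine Finset.sum_sq_le_sum_mul_sum_of_sq_le_mul _ (fun k _ => div_nonneg (sq_nonneg _) (hp k))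
    (fun k _ => hp k) (fun k _ => ?_)
  by_cases h : p k = 0
  · simp [h, hg k h]
  · exact le_of_eq (by field_simp)

theorem card_mul_sq_le_one_of_dephasing {ι κ γ β : Type*} [Fintype ι] [Fintype κ] [Fintype γ]
    [Fintype β] [DecidableEq ι] [DecidableEq κ] [DecidableEq β]
    (C : Matrix ((ι × κ) × γ) (ι × β) ℂ) (l : β → ℝ) (p : κ → ℝ)
    (hl : ∀ b, 0 ≤ l b) (hl1 : ∑ b, l b = 1) (hp : ∀ k, 0 ≤ p k) (hp1 : ∑ k, p k = 1)
    (hiso : Cᴴ * C = 1)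
    (hout : ∀ j j' a a', ∑ c, ∑ b, (l b : ℂ) * (C (a, c) (j, b) * star (C (a', c) (j', b)))
      = if j = j' ∧ a = a' ∧ a.1 = j then (p a.2 : ℂ) else 0)
    (hcomp : ∀ j j' c c', ∑ a, ∑ b, (l b : ℂ) * (C (a, c) (j, b) * star (C (a, c') (j, b)))
      = ∑ a, ∑ b, (l b : ℂ) * (C (a, c) (j', b) * star (C (a, c') (j', b))))
    (b₀ : β) : (Fintype.card ι : ℝ) * l b₀ ^ 2 ≤ 1 := by
  classical
  rcases isEmpty_or_nonempty ι with hι | ⟨⟨j₀⟩⟩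
  · simp
  rcases (hl b₀).eq_or_lt with hs | hs
  · simp [← hs]
  -- the compressed vectors
  let w : ι × κ → EuclideanSpace ℂ (γ × β) := fun q =>
    WithLp.toLp 2 fun r => ((Real.sqrt (l r.2) : ℝ) : ℂ) * C (q, r.1) (q.1, r.2)
  -- The rank-one operators of these vectors sum to `τ ⊗ |b₀⟩⟨b₀|`, with `τ` computed from the input
  -- `j₀`.
  let t : ((ι × κ) × β) → EuclideanSpace ℂ (γ × β) := fun q =>
    WithLp.toLp 2 fun r => if r.2 = b₀ then ((Real.sqrt (l q.2) : ℝ) : ℂ) * C (q.1, r.1) (j₀, q.2)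
      else 0
  have hsq : ∀ b, ((Real.sqrt (l b) : ℝ) : ℂ) * ((Real.sqrt (l b) : ℝ) : ℂ) = (l b : ℂ) := by
    intro b
    rw [← Complex.ofReal_mul, Real.mul_self_sqrt (hl b)]
  have hww : ∀ q q', inner ℂ (w q) (w q') = if q = q' then (p q.2 : ℂ) else 0 := by
    intro q q'
    have h := hout q'.1 q.1 q' q
    rw [show (if q = q' then (p q.2 : ℂ) else 0)
      = if q'.1 = q.1 ∧ q' = q ∧ q'.1 = q'.1 then (p q'.2 : ℂ) else 0 by
        by_cases e : q = q'
        · simp [e]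
        · simp [e, Ne.symm e], ← h]
    simp only [w, PiLp.inner_apply, Fintype.sum_prod_type, RCLike.inner_apply]
    refine Finset.sum_congr rfl fun c _ => Finset.sum_congr rfl fun b _ => ?_
    rw [← hsq b]
    simp
    ring
  have hwn : ∀ q, ‖w q‖ ^ 2 = p q.2 := by
    intro q
    have h := inner_self_eq_norm_sq_to_K (𝕜 := ℂ) (w q)
    rw [hww, if_pos rfl] at h
    exact Complex.ofReal_injective (by simpa using h.symm)
  -- norm squares of the columns
  have hcol : ∀ j b, ∑ a, ∑ c, ‖C (a, c) (j, b)‖ ^ 2 = 1 := by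
    intro j b
    have h := congrFun (congrFun hiso (j, b)) (j, b)
    simp only [Matrix.mul_apply, Matrix.conjTranspose_apply, Matrix.one_apply_eq] at h
    rw [Fintype.sum_prod_type] at h
    have h2 : ∀ z : ℂ, star z * z = ((‖z‖ ^ 2 : ℝ) : ℂ) := by
      intro z; simpa using Complex.conj_mul' z
    simp only [h2] at h
    exact_mod_cast h
  have htn : ∑ q, ‖t q‖ ^ 2 = 1 := by
    have h1 : ∀ q, ‖t q‖ ^ 2 = l q.2 * ∑ c, ‖C (q.1, c) (j₀, q.2)‖ ^ 2 := by
      intro q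
      simp only [t, EuclideanSpace.norm_sq_eq, Fintype.sum_prod_type]
      rw [Finset.mul_sum]
      refine Finset.sum_congr rfl fun c _ => ?_
      rw [Finset.sum_eq_single b₀ (by intro b _ hb; simp [hb]) (by simp)]
      simp [mul_pow, Real.sq_sqrt (hl q.2)]
    simp only [h1, Fintype.sum_prod_type]
    rw [Finset.sum_congr rfl fun i _ => Finset.sum_comm, Finset.sum_comm]
    rw [← hl1]
    refine Finset.sum_congr rfl fun b _ => ?_
    have := hcol j₀ b
    rw [Fintype.sum_prod_type] at this
    simp only [← Finset.mul_sum, this, mul_one]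
  let g : ι → κ → ℝ := fun j k => ∑ c, ‖C ((j, k), c) (j, b₀)‖ ^ 2
  -- A vanishing diagonal entry of the output is a sum of nonnegative terms; `l b₀ > 0` allows the
  -- weight to be cancelled.
  have hzero : ∀ j a, (a.1 = j → p a.2 = 0) → ∀ c, C (a, c) (j, b₀) = 0 := by
    intro j a ha c
    have h := hout j j a a
    have h2 : ∀ z : ℂ, z * star z = ((‖z‖ ^ 2 : ℝ) : ℂ) := by
      intro z; simpa using Complex.mul_conj' z
    have h3 : (if j = j ∧ a = a ∧ a.1 = j then (p a.2 : ℂ) else 0) = ((0 : ℝ) : ℂ) := by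
      split_ifs with h'
      · rw [ha h'.2.2]
      · simp
    rw [h3] at h
    simp only [h2] at h
    have h4 : ∑ c, ∑ b, l b * ‖C (a, c) (j, b)‖ ^ 2 = 0 := by exact_mod_cast h
    have h5 := (Finset.sum_eq_zero_iff_of_nonneg (fun c _ => Finset.sum_nonneg fun b _ =>
      mul_nonneg (hl b) (sq_nonneg _))).mp h4 c (Finset.mem_univ _)
    have h6 := (Finset.sum_eq_zero_iff_of_nonneg (fun b _ =>
      mul_nonneg (hl b) (sq_nonneg _))).mp h5 b₀ (Finset.mem_univ _)
    simpa [hs.ne'] using h6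
  have hg1 : ∀ j, ∑ k, g j k = 1 := by
    intro j
    rw [← hcol j b₀, Fintype.sum_prod_type]
    rw [Finset.sum_eq_single j _ (by simp)]
    intro i _ hi
    refine Finset.sum_eq_zero fun k _ => Finset.sum_eq_zero fun c _ => ?_
    rw [hzero j (i, k) (fun h => absurd h hi) c]
    simp
  have hg0 : ∀ j k, p k = 0 → g j k = 0 := by
    intro j k hk
    refine Finset.sum_eq_zero fun c _ => ?_
    rw [hzero j (j, k) (fun _ => hk) c]
    simp
  -- quadratic forms of the complementary output
  let Q : ι → (γ → ℂ) → ℝ := fun j x => ∑ a, ∑ b, l b * ‖∑ c, star (x c) * C (a, c) (j, b)‖ ^ 2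
  have hQ : ∀ j x, (Q j x : ℂ) = ∑ c, ∑ c', star (x c) * x c' *
      ∑ a, ∑ b, (l b : ℂ) * (C (a, c) (j, b) * star (C (a, c') (j, b))) := by
    intro j x
    have h2 : ∀ z : ℂ, ((‖z‖ ^ 2 : ℝ) : ℂ) = z * star z := by
      intro z; simpa using (Complex.mul_conj' z).symm
    have h3 : ∀ a b, (l b : ℂ) * ((∑ c, star (x c) * C (a, c) (j, b)) *
        star (∑ c, star (x c) * C (a, c) (j, b))) = ∑ c, ∑ c', star (x c) * x c' *
          ((l b : ℂ) * (C (a, c) (j, b) * star (C (a, c') (j, b)))) := by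
      intro a b
      rw [star_sum, Finset.sum_mul_sum, Finset.mul_sum]
      refine Finset.sum_congr rfl fun c _ => ?_
      rw [Finset.mul_sum]
      refine Finset.sum_congr rfl fun c' _ => ?_
      simp
      ring
    simp only [Q, Complex.ofReal_sum, Complex.ofReal_mul, h2, h3, Finset.mul_sum]
    simp only [← Fintype.sum_prod_type']
    exact Fintype.sum_equiv ⟨fun r => (r.2.2.1, r.2.2.2, r.1, r.2.1),
      fun r => (r.2.2.1, r.2.2.2, r.1, r.2.1), fun _ => rfl, fun _ => rfl⟩ _ _ fun _ => rfl
  have hQj : ∀ j x, Q j x = Q j₀ x := by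
    intro j x
    have : (Q j x : ℂ) = Q j₀ x := by
      rw [hQ, hQ]
      refine Finset.sum_congr rfl fun c _ => Finset.sum_congr rfl fun c' _ => ?_
      rw [hcomp j j₀]
    exact_mod_cast this
  have hlow : ∀ j k, l b₀ ^ 2 * g j k ^ 2 ≤ ∑ q, ‖inner ℂ (w (j, k)) (t q)‖ ^ 2 := by
    intro j k
    let x : γ → ℂ := fun c => C ((j, k), c) (j, b₀)
    have h1 : ∀ q, ‖inner ℂ (w (j, k)) (t q)‖ ^ 2
        = l b₀ * (l q.2 * ‖∑ c, star (x c) * C (q.1, c) (j₀, q.2)‖ ^ 2) := by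
      intro q
      have : inner ℂ (w (j, k)) (t q) = ((Real.sqrt (l b₀) : ℝ) : ℂ) *
          (((Real.sqrt (l q.2) : ℝ) : ℂ) * ∑ c, star (x c) * C (q.1, c) (j₀, q.2)) := by
        simp only [w, t, x, PiLp.inner_apply, Fintype.sum_prod_type, RCLike.inner_apply,
          Finset.mul_sum]
        refine Finset.sum_congr rfl fun c _ => ?_
        rw [Finset.sum_eq_single b₀ (by intro b _ hb; simp [hb]) (by simp)]
        simp
        ring
      rw [this]
      simp [mul_pow, Real.sq_sqrt (hl _)]
    have h2 : ∑ q, ‖inner ℂ (w (j, k)) (t q)‖ ^ 2 = l b₀ * Q j₀ x := by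
      simp only [h1, ← Finset.mul_sum]
      rw [Fintype.sum_prod_type]
    -- After replacing the input `j₀` by `j`, the single term `a = (j, k)`, `b = b₀` of the sum
    -- suffices: there the inner product is `‖x‖² = g j k`.
    rw [h2, ← hQj j x, pow_two, mul_assoc]
    refine mul_le_mul_of_nonneg_left ?_ (hl _)
    have h3 : l b₀ * g j k ^ 2 = l b₀ * ‖∑ c, star (x c) * C ((j, k), c) (j, b₀)‖ ^ 2 := by
      congr 1
      have h4 : ∑ c, star (x c) * C ((j, k), c) (j, b₀) = ((g j k : ℝ) : ℂ) := by
        simp only [g, x, Complex.ofReal_sum]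
        refine Finset.sum_congr rfl fun c _ => ?_
        simpa using Complex.conj_mul' (C ((j, k), c) (j, b₀))
      rw [h4]
      simp
    rw [h3]
    refine le_trans (Finset.single_le_sum (f := fun b => l b *
      ‖∑ c, star (x c) * C ((j, k), c) (j, b)‖ ^ 2)
      (fun b _ => mul_nonneg (hl b) (sq_nonneg _)) (Finset.mem_univ b₀)) ?_
    exact Finset.single_le_sum (f := fun a => ∑ b, l b *
      ‖∑ c, star (x c) * C (a, c) (j, b)‖ ^ 2)
      (fun a _ => Finset.sum_nonneg fun b _ => mul_nonneg (hl b) (sq_nonneg _))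
      (Finset.mem_univ (j, k))
  have hbessel : ∑ q, ∑ r, ‖inner ℂ (w r) (t q)‖ ^ 2 / p r.2 ≤ 1 := by
    rw [← htn]
    refine Finset.sum_le_sum fun q _ => ?_
    have := sum_norm_inner_sq_div_le_of_pairwise_orthogonal w
      (fun i j hij => by rw [hww, if_neg hij]) (t q)
    simpa only [hwn] using this
  calc (Fintype.card ι : ℝ) * l b₀ ^ 2 = ∑ _j : ι, l b₀ ^ 2 * 1 := by simp
    _ ≤ ∑ j, l b₀ ^ 2 * ∑ k, g j k ^ 2 / p k := by
      refine Finset.sum_le_sum fun j _ => mul_le_mul_of_nonneg_left ?_ (sq_nonneg _)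
      have := sq_sum_le_sum_sq_div_mul_sum (g j) p hp (hg0 j)
      rw [hg1, hp1] at this
      simpa using this
    _ = ∑ r : ι × κ, l b₀ ^ 2 * g r.1 r.2 ^ 2 / p r.2 := by
      rw [Fintype.sum_prod_type]
      simp only [Finset.mul_sum, mul_div_assoc]
    _ ≤ ∑ r : ι × κ, (∑ q, ‖inner ℂ (w r) (t q)‖ ^ 2) / p r.2 :=
      Finset.sum_le_sum fun r _ => div_le_div_of_nonneg_right (hlow r.1 r.2) (hp _)
    _ = ∑ q, ∑ r, ‖inner ℂ (w r) (t q)‖ ^ 2 / p r.2 := by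
      rw [Finset.sum_comm]
      simp only [Finset.sum_div]
    _ ≤ 1 := hbessel

/-! ### Partial traces under local operations. -/

section PartialTrace

variable {α β δ : Type*}

theorem partialTraceRight_add [Fintype β] (M N : Matrix (α × β) (α × β) ℂ) :
    partialTraceRight (M + N) = partialTraceRight M + partialTraceRight N := by
  ext i j
  simp [partialTraceRight, Finset.sum_add_distrib]

theorem partialTraceRight_smul [Fintype β] (c : ℂ) (M : Matrix (α × β) (α × β) ℂ) :
    partialTraceRight (c • M) = c • partialTraceRight M := by
  ext i j
  simp [partialTraceRight, Finset.mul_sum]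

theorem kronecker_one_mul_apply [Fintype α] [Fintype β] [DecidableEq β] (K : Matrix δ α ℂ) {γ : Type*}
    (M : Matrix (α × β) γ ℂ) (x : δ) (c : β) (r : γ) :
    ((K ⊗ₖ (1 : Matrix β β ℂ)) * M) (x, c) r = ∑ a, K x a * M (a, c) r := by
  simp [Matrix.mul_apply, Fintype.sum_prod_type, Matrix.kroneckerMap_apply, Matrix.one_apply]

theorem mul_kronecker_one_conjTranspose_apply [Fintype α] [Fintype β] [DecidableEq β] (K : Matrix δ α ℂ) {γ : Type*}
    (M : Matrix γ (α × β) ℂ) (x : δ) (c : β) (r : γ) :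
    (M * (K ⊗ₖ (1 : Matrix β β ℂ))ᴴ) r (x, c) = ∑ a, M r (a, c) * star (K x a) := by
  simp [Matrix.mul_apply, Fintype.sum_prod_type, Matrix.kroneckerMap_apply, Matrix.one_apply,
    apply_ite (starRingEnd ℂ)]

theorem partialTraceRight_conj_kronecker_one [Fintype α] [Fintype β] [DecidableEq β] (K : Matrix δ α ℂ)
    (M : Matrix (α × β) (α × β) ℂ) :
    partialTraceRight ((K ⊗ₖ (1 : Matrix β β ℂ)) * M * (K ⊗ₖ (1 : Matrix β β ℂ))ᴴ)
      = K * partialTraceRight M * Kᴴ := by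
  ext x y
  simp only [partialTraceRight, mul_kronecker_one_conjTranspose_apply, kronecker_one_mul_apply]
  simp only [Matrix.mul_apply, Matrix.conjTranspose_apply, partialTraceRight]
  rw [Finset.sum_comm]
  refine Finset.sum_congr rfl fun a _ => ?_
  rw [← Finset.sum_mul, Finset.sum_comm]
  simp only [Finset.mul_sum]

theorem partialTraceLeft_conj_kronecker_one [Fintype α] [Fintype β] [Fintype δ]
    [DecidableEq α] [DecidableEq β] (K : Matrix δ α ℂ)
    (hK : Kᴴ * K = 1) (M : Matrix (α × β) (α × β) ℂ) :
    partialTraceLeft ((K ⊗ₖ (1 : Matrix β β ℂ)) * M * (K ⊗ₖ (1 : Matrix β β ℂ))ᴴ)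
      = partialTraceLeft M := by
  ext c c'
  simp only [partialTraceLeft, mul_kronecker_one_conjTranspose_apply, kronecker_one_mul_apply]
  have h : ∀ a a', ∑ x, star (K x a) * K x a' = if a = a' then 1 else 0 := by
    intro a a'
    have := congrFun (congrFun hK a) a'
    simpa [Matrix.mul_apply, Matrix.one_apply] using this
  calc ∑ x, ∑ a, (∑ a', K x a' * M (a', c) (a, c')) * star (K x a)
      = ∑ x, ∑ a, ∑ a', M (a', c) (a, c') * (star (K x a) * K x a') := by
        refine Finset.sum_congr rfl fun x _ => Finset.sum_congr rfl fun a _ => ?_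
        rw [Finset.sum_mul]
        exact Finset.sum_congr rfl fun a' _ => by ring
    _ = ∑ a, ∑ a', M (a', c) (a, c') * ∑ x, star (K x a) * K x a' := by
        rw [Finset.sum_comm]
        refine Finset.sum_congr rfl fun a _ => ?_
        rw [Finset.sum_comm]
        simp only [Finset.mul_sum]
    _ = ∑ a, M (a, c) (a, c') := by
        simp only [h]
        simp

end PartialTrace

/-! ### Linear extension from states, and passage to eigenbases. -/

/-- States span all matrices, by scaling and polarization. This extends the dephasing identity to
the inputs `|j⟩⟨j'|`, which give the orthogonality of the blocks. -/
theorem induction_on_density_matrices {n : Type*} [Fintype n] [DecidableEq n]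
    {P : Matrix n n ℂ → Prop} (h0 : P 0) (hadd : ∀ X Y, P X → P Y → P (X + Y))
    (hsmul : ∀ (c : ℂ) X, P X → P (c • X))
    (hstate : ∀ X : Matrix n n ℂ, X.PosSemidef → X.trace = 1 → P X) (X : Matrix n n ℂ) : P X := by
  have hpsd : ∀ X : Matrix n n ℂ, X.PosSemidef → P X := by
    intro X hX
    by_cases ht : X.trace = 0
    · rw [hX.trace_eq_zero_iff.mp ht]
      exact h0
    · have := hsmul X.trace _ (hstate (X.trace⁻¹ • X) (hX.smul (by
        have := hX.trace_nonneg
        exact inv_nonneg.mpr this)) (by simp [ht]))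
      rwa [smul_smul, mul_inv_cancel₀ ht, one_smul] at this
  have hrank : ∀ x y : n → ℂ, P (Matrix.vecMulVec x (star y)) := by
    intro x y
    have hp : ∀ z : n → ℂ, P (Matrix.vecMulVec z (star z)) := fun z =>
      hpsd _ (Matrix.posSemidef_vecMulVec_self_star z)
    have key : Matrix.vecMulVec x (star y) =
        ((1 / 4 : ℂ) • Matrix.vecMulVec (x + y) (star (x + y)) +
        (-1 / 4 : ℂ) • Matrix.vecMulVec (x - y) (star (x - y))) +
        ((Complex.I / 4) • Matrix.vecMulVec (x + Complex.I • y) (star (x + Complex.I • y)) +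
        (-Complex.I / 4) • Matrix.vecMulVec (x - Complex.I • y) (star (x - Complex.I • y))) := by
      ext i j
      simp [Matrix.vecMulVec_apply]
      ring_nf
      simp
      ring
    rw [key]
    exact hadd _ _ (hadd _ _ (hsmul _ _ (hp _)) (hsmul _ _ (hp _)))
      (hadd _ _ (hsmul _ _ (hp _)) (hsmul _ _ (hp _)))
  refine Matrix.induction_on' X h0 hadd fun i j c => ?_
  have : Matrix.single i j c = c • Matrix.vecMulVec (Pi.single i 1) (star (Pi.single j (1 : ℂ))) := by
    ext a b
    simp [Matrix.vecMulVec_apply, Matrix.single_apply, Pi.single_apply, ite_and, eq_comm]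
    split_ifs <;> simp
  rw [this]
  exact hsmul _ _ (hrank _ _)

/-- The unitary matrix whose columns are the vectors of an orthonormal basis. -/
noncomputable def OrthonormalBasis.columns {n : ℕ} (e : OrthonormalBasis (Fin n) ℂ (EuclideanSpace ℂ (Fin n))) :
    Matrix (Fin n) (Fin n) ℂ :=
  Matrix.of fun x i => (e i).ofLp x

section Dephased

variable {n : ℕ} (e : OrthonormalBasis (Fin n) ℂ (EuclideanSpace ℂ (Fin n)))

theorem OrthonormalBasis.columns_conjTranspose_mul_self : e.columnsᴴ * e.columns = 1 := by
  ext i j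
  have := e.inner_eq_ite i j
  rw [PiLp.inner_apply] at this
  rw [Matrix.one_apply, ← this]
  simp [columns, Matrix.mul_apply, mul_comm]

theorem OrthonormalBasis.columns_mul_conjTranspose : e.columns * e.columnsᴴ = 1 :=
  mul_eq_one_comm.mp e.columns_conjTranspose_mul_self

theorem dephased_eq_columns (ρ : Matrix (Fin n) (Fin n) ℂ) :
    dephased e ρ = e.columns * Matrix.diagonal (fun i => (e.columnsᴴ * ρ * e.columns) i i)
      * e.columnsᴴ := by
  ext x y
  have h : ∀ i, star (e i).ofLp ⬝ᵥ (ρ *ᵥ (e i).ofLp) = (e.columnsᴴ * ρ * e.columns) i i := by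
    intro i
    rw [Matrix.mul_assoc]
    simp [OrthonormalBasis.columns, Matrix.mul_apply, dotProduct, Matrix.mulVec]
  rw [dephased, Matrix.sum_apply, Matrix.mul_apply]
  refine Finset.sum_congr rfl fun i _ => ?_
  rw [h, Matrix.mul_diagonal]
  simp [Matrix.vecMulVec_apply, OrthonormalBasis.columns]
  ring

theorem dephased_add (X Y : Matrix (Fin n) (Fin n) ℂ) :
    dephased e (X + Y) = dephased e X + dephased e Y := by
  simp [dephased, Matrix.add_mulVec, add_smul, Finset.sum_add_distrib]

theorem dephased_smul (c : ℂ) (X : Matrix (Fin n) (Fin n) ℂ) :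
    dephased e (c • X) = c • dephased e X := by
  simp [dephased, Matrix.smul_mulVec, Finset.smul_sum, smul_smul]

end Dephased

theorem IsDephasing.output_of_matrix {n : ℕ}
    {e : OrthonormalBasis (Fin n) ℂ (EuclideanSpace ℂ (Fin n))} {σ η τ : QState}
    {U : Matrix ((Fin n × Fin η.dim) × Fin τ.dim) (Fin n × Fin σ.dim) ℂ}
    (h : IsDephasing e σ η τ U) (X : Matrix (Fin n) (Fin n) ℂ) :
    partialTraceRight (U * (X ⊗ₖ σ.mat) * Uᴴ) = dephased e X ⊗ₖ η.mat := by
  induction X using induction_on_density_matrices with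
  | h0 =>
    have h1 : dephased e (0 : Matrix (Fin n) (Fin n) ℂ) = 0 := by simp [dephased]
    rw [h1, Matrix.zero_kronecker, Matrix.zero_kronecker]
    ext
    simp [partialTraceRight]
  | hadd X Y hX hY =>
    rw [Matrix.add_kronecker, Matrix.mul_add, Matrix.add_mul, partialTraceRight_add, hX, hY,
      dephased_add, Matrix.add_kronecker]
  | hsmul c X hX =>
    rw [Matrix.smul_kronecker, Matrix.mul_smul, Matrix.smul_mul, partialTraceRight_smul, hX,
      dephased_smul, Matrix.smul_kronecker]
  | hstate X hX hX1 => exact h.output X hX hX1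

theorem mul_single_kronecker_diagonal_mul_conjTranspose_apply {ι β δ : Type*} [Fintype ι]
    [Fintype β] [DecidableEq ι] [DecidableEq β] (C : Matrix δ (ι × β) ℂ) (l : β → ℂ) (j j' : ι)
    (r r' : δ) :
    (C * (Matrix.single j j' 1 ⊗ₖ Matrix.diagonal l) * Cᴴ : Matrix δ δ ℂ) r r'
      = ∑ b, l b * (C r (j, b) * star (C r' (j', b))) := by
  have h : ∀ x b, (C * (Matrix.single j j' 1 ⊗ₖ Matrix.diagonal l) : Matrix δ (ι × β) ℂ) r (x, b)
      = if x = j' then C r (j, b) * l b else 0 := by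
    intro x b
    simp only [Matrix.mul_apply, Matrix.kroneckerMap_apply, Fintype.sum_prod_type]
    rw [Finset.sum_eq_single j _ (by simp)]
    · rw [Finset.sum_eq_single b _ (by simp)]
      · simp [Matrix.single_apply, eq_comm]
      · intro b' _ hb
        simp [Matrix.diagonal_apply_ne _ hb]
    · intro i _ hi
      simp [hi.symm]
  rw [Matrix.mul_apply, Fintype.sum_prod_type]
  simp only [h, Matrix.conjTranspose_apply]
  rw [Finset.sum_eq_single j' (by intro x _ hx; simp [hx]) (by simp)]
  exact Finset.sum_congr rfl fun b _ => by simp; ring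

theorem eigenvalues_sum_eq_one (σ : QState) : ∑ b, σ.posSemidef.isHermitian.eigenvalues b = 1 := by
  have h := σ.posSemidef.isHermitian.trace_eq_sum_eigenvalues
  rw [σ.trace_eq_one] at h
  exact Complex.ofReal_injective (by simpa using h.symm)

theorem QState.exists_diagonalization (σ : QState) : ∃ V : Matrix (Fin σ.dim) (Fin σ.dim) ℂ,
    Vᴴ * V = 1 ∧ V * Vᴴ = 1 ∧
      σ.mat = V * Matrix.diagonal (fun b => (σ.posSemidef.isHermitian.eigenvalues b : ℂ)) * Vᴴ := by
  refine ⟨σ.posSemidef.isHermitian.eigenvectorUnitary, ?_, ?_, ?_⟩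
  · exact Unitary.coe_star_mul_self _
  · exact Unitary.coe_mul_star_self _
  · have h := σ.posSemidef.isHermitian.spectral_theorem
    rw [Unitary.conjStarAlgAut_apply] at h
    exact h

theorem kronecker_conj {m n : Type*} [Fintype m] [Fintype n] (E A : Matrix m m ℂ)
    (F B : Matrix n n ℂ) :
    (E ⊗ₖ F)ᴴ * (A ⊗ₖ B) * ((E ⊗ₖ F)ᴴ)ᴴ = (Eᴴ * A * E) ⊗ₖ (Fᴴ * B * F) := by
  rw [Matrix.conjTranspose_conjTranspose, Matrix.conjTranspose_kronecker,
    ← Matrix.mul_kronecker_mul, ← Matrix.mul_kronecker_mul]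

theorem conj_mul_mul_cancel {n : Type*} [Fintype n] [DecidableEq n] {E : Matrix n n ℂ}
    (hE : Eᴴ * E = 1) (X : Matrix n n ℂ) : Eᴴ * (E * X * Eᴴ) * E = X := by
  calc Eᴴ * (E * X * Eᴴ) * E = (Eᴴ * E) * X * (Eᴴ * E) := by simp only [Matrix.mul_assoc]
    _ = X := by rw [hE, Matrix.one_mul, Matrix.mul_one]

theorem OrthonormalBasis.columns_conj_dephased {n : ℕ}
    (e : OrthonormalBasis (Fin n) ℂ (EuclideanSpace ℂ (Fin n))) (X : Matrix (Fin n) (Fin n) ℂ) :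
    e.columnsᴴ * dephased e (e.columns * X * e.columnsᴴ) * e.columns
      = Matrix.diagonal fun i => X i i := by
  rw [dephased_eq_columns, conj_mul_mul_cancel e.columns_conjTranspose_mul_self,
    conj_mul_mul_cancel e.columns_conjTranspose_mul_self]

/-- Conjugating `U` by unitaries to the basis `e` and the eigenbases of `σ` and `η` makes all the
data diagonal; `B'` needs no change of basis. -/
theorem DephasesInto.mul_sq_eigenvalues_le_one {n : ℕ} {σ τ : QState} (h : DephasesInto n σ τ)
    (b : Fin σ.dim) : (n : ℝ) * σ.posSemidef.isHermitian.eigenvalues b ^ 2 ≤ 1 := by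
  obtain ⟨e, η, U, hU⟩ := h
  obtain ⟨V, hV, hV', hσ⟩ := σ.exists_diagonalization
  obtain ⟨F, hF, hF', hη⟩ := η.exists_diagonalization
  have hFd := conj_mul_mul_cancel hF (Matrix.diagonal fun b =>
    (η.posSemidef.isHermitian.eigenvalues b : ℂ))
  rw [← hη] at hFd
  set l := σ.posSemidef.isHermitian.eigenvalues with hl
  set p := η.posSemidef.isHermitian.eigenvalues with hp
  set E := e.columns with hE
  have hE1 : Eᴴ * E = 1 := e.columns_conjTranspose_mul_self
  have hE2 : E * Eᴴ = 1 := e.columns_mul_conjTranspose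
  set K := (E ⊗ₖ F)ᴴ with hK
  have hK1 : Kᴴ * K = 1 := by
    rw [hK, Matrix.conjTranspose_conjTranspose, Matrix.conjTranspose_kronecker,
      ← Matrix.mul_kronecker_mul, hE2, hF', Matrix.one_kronecker_one]
  set G := K ⊗ₖ (1 : Matrix (Fin τ.dim) (Fin τ.dim) ℂ) with hG
  have hG1 : Gᴴ * G = 1 := by
    rw [hG, Matrix.conjTranspose_kronecker, ← Matrix.mul_kronecker_mul, hK1]
    simp
  set C := G * U * (E ⊗ₖ V) with hC
  have hconj : ∀ j j', C * (Matrix.single j j' 1 ⊗ₖ Matrix.diagonal fun b => (l b : ℂ)) * Cᴴ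
      = G * (U * ((E * Matrix.single j j' 1 * Eᴴ) ⊗ₖ σ.mat) * Uᴴ) * Gᴴ := by
    intro j j'
    rw [hσ, Matrix.mul_kronecker_mul, Matrix.mul_kronecker_mul, hC, Matrix.conjTranspose_mul,
      Matrix.conjTranspose_mul, ← Matrix.conjTranspose_kronecker]
    simp only [Matrix.mul_assoc]
  have hcard := card_mul_sq_le_one_of_dephasing C l p σ.posSemidef.eigenvalues_nonneg
    (eigenvalues_sum_eq_one σ) η.posSemidef.eigenvalues_nonneg (eigenvalues_sum_eq_one η)
    ?_ ?_ ?_ b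
  · simpa using hcard
  · calc Cᴴ * C = (E ⊗ₖ V)ᴴ * (Uᴴ * (Gᴴ * G) * U) * (E ⊗ₖ V) := by
          rw [hC, Matrix.conjTranspose_mul, Matrix.conjTranspose_mul]
          simp only [Matrix.mul_assoc]
      _ = 1 := by
          rw [hG1, Matrix.mul_one, hU.isometry, Matrix.mul_one, Matrix.conjTranspose_kronecker,
            ← Matrix.mul_kronecker_mul, hE1, hV, Matrix.one_kronecker_one]
  · intro j j' a a'
    have h1 := congrFun (congrFun (congrArg partialTraceRight (hconj j j')) a) a'
    have h3 : K * (dephased e (E * Matrix.single j j' 1 * Eᴴ) ⊗ₖ η.mat) * Kᴴ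
        = (Matrix.diagonal fun i => Matrix.single j j' (1 : ℂ) i i) ⊗ₖ
          Matrix.diagonal fun b => (p b : ℂ) := by
      rw [hK, kronecker_conj, hE, e.columns_conj_dephased, hFd]
    rw [partialTraceRight_conj_kronecker_one, hU.output_of_matrix, h3] at h1
    simp only [partialTraceRight] at h1
    simp only [mul_single_kronecker_diagonal_mul_conjTranspose_apply C (fun b => (l b : ℂ))] at h1
    rw [h1]
    obtain ⟨i, k⟩ := a
    obtain ⟨i', k'⟩ := a'
    simp only [Matrix.kroneckerMap_apply, Matrix.diagonal_apply, Matrix.single_apply, Prod.mk.injEq]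
    rcases eq_or_ne i i' with rfl | h5
    · rcases eq_or_ne k k' with rfl | h6
      · by_cases h7 : j = i
        · subst h7
          simp [eq_comm]
        · simp [h7, Ne.symm h7]
      · simp [h6]
    · simp [h5]
  · intro j j' c c'
    have h2 : ∀ j, ∑ a, ∑ b, (l b : ℂ) * (C (a, c) (j, b) * star (C (a, c') (j, b)))
        = τ.mat c c' := by
      intro j
      have h1 := congrFun (congrFun (congrArg partialTraceLeft (hconj j j)) c) c'
      rw [partialTraceLeft_conj_kronecker_one _ hK1, hU.complement] at h1
      · simp only [partialTraceLeft] at h1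
        simpa only [mul_single_kronecker_diagonal_mul_conjTranspose_apply C
          (fun b => (l b : ℂ))] using h1
      · refine Matrix.PosSemidef.mul_mul_conjTranspose_same ?_ _
        rw [← Matrix.diagonal_single]
        refine Matrix.PosSemidef.diagonal fun i => ?_
        by_cases hi : i = j <;> simp [hi]
      · rw [Matrix.trace_mul_comm, ← Matrix.mul_assoc, hE1, Matrix.one_mul]
        simp
    rw [h2, h2]

/-! ### Mixtures of uniform distributions on `d`-element sets. -/

/-- The vertices of the hypersimplex are the indicators of `d`-element sets. Greedy removal of
multiples of indicators lowers the number of coordinates strictly between `0` and `t`; the total `t`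
is left free because each removal shrinks it. -/
theorem exists_weights_card_eq {β : Type*} [Fintype β] [DecidableEq β] (d : ℕ) (hd : 1 ≤ d)
    (x : β → ℝ) (t : ℝ) (ht : 0 ≤ t) (h0 : ∀ b, 0 ≤ x b) (h1 : ∀ b, x b ≤ t)
    (hs : ∑ b, x b = d * t) :
    ∃ p : {S : Finset β // S.card = d} → ℝ, (∀ S, 0 ≤ p S) ∧ ∑ S, p S = t ∧
      ∀ b, ∑ S, (if b ∈ S.1 then p S else 0) = x b := by
  induction hk : (Finset.univ.filter fun b => 0 < x b ∧ x b < t).card using Nat.strong_induction_on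
    generalizing x t with
  | _ k ih =>
  rcases ht.eq_or_lt with rfl | ht
  · exact ⟨0, by simp, by simp, fun b => by simpa using le_antisymm (h0 b) (h1 b)⟩
  have hd' : (0 : ℝ) < d := by exact_mod_cast hd
  -- `S` must contain the coordinates equal to `t`, which have to decrease, and avoid those equal to
  -- `0`. The sum `d * t` puts `d` between the two cardinalities.
  obtain ⟨S, hAS, hSB, hS⟩ := Finset.exists_subsuperset_card_eq (n := d)
    (s := Finset.univ.filter fun b => x b = t) (t := Finset.univ.filter fun b => 0 < x b)
    (fun b => by simp; intro h; rw [h]; exact ht)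
    (by
      have : ((Finset.univ.filter fun b => x b = t).card : ℝ) * t ≤ d * t := by
        rw [← hs, ← nsmul_eq_mul, ← Finset.sum_const]
        refine le_trans (le_of_eq (Finset.sum_congr rfl fun b hb => ?_))
          (Finset.sum_le_univ_sum_of_nonneg h0)
        simpa using (Finset.mem_filter.mp hb).2.symm
      exact_mod_cast le_of_mul_le_mul_right this ht)
    (by
      have : (d : ℝ) * t ≤ ((Finset.univ.filter fun b => 0 < x b).card : ℝ) * t := by
        rw [← hs, ← nsmul_eq_mul, ← Finset.sum_const, Finset.sum_filter]
        refine Finset.sum_le_sum fun b _ => ?_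
        split_ifs with h
        · exact h1 b
        · exact not_lt.mp h
      exact_mod_cast le_of_mul_le_mul_right this ht)
  have hSpos : ∀ b ∈ S, 0 < x b := fun b hb => (Finset.mem_filter.mp (hSB hb)).2
  have hSlt : ∀ b ∉ S, x b < t := fun b hb =>
    lt_of_le_of_ne (h1 b) fun h => hb (hAS (by simp [h]))
  obtain ⟨b₁, hb₁⟩ : S.Nonempty := Finset.card_pos.mp (by omega)
  -- How much can be removed along `S` before coordinate `b` reaches `0` (inside `S`) or the new
  -- upper bound (outside `S`).
  let f : β → ℝ := fun b => if b ∈ S then x b else t - x b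
  obtain ⟨b₀, -, hb₀⟩ := Finset.exists_min_image Finset.univ f ⟨b₁, Finset.mem_univ _⟩
  set ε := f b₀ with hε
  have hε0 : 0 < ε := by
    simp only [hε, f]
    split_ifs with h
    · exact hSpos _ h
    · linarith [hSlt _ h]
  have hεS : ∀ b ∈ S, ε ≤ x b := fun b hb => by simpa [f, hb] using hb₀ b (Finset.mem_univ _)
  have hεS' : ∀ b ∉ S, ε ≤ t - x b := fun b hb => by simpa [f, hb] using hb₀ b (Finset.mem_univ _)
  let x' : β → ℝ := fun b => x b - if b ∈ S then ε else 0
  have hx0 : ∀ b, 0 ≤ x' b := by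
    intro b
    simp only [x']
    split_ifs with h
    · linarith [hεS b h]
    · linarith [h0 b]
  have hx1 : ∀ b, x' b ≤ t - ε := by
    intro b
    simp only [x']
    split_ifs with h
    · linarith [h1 b]
    · linarith [hεS' b h]
  have hxs : ∑ b, x' b = d * (t - ε) := by
    simp only [x', Finset.sum_sub_distrib, hs]
    simp [hS]
    ring
  have ht' : 0 ≤ t - ε := by linarith [hεS b₁ hb₁, h1 b₁]
  obtain ⟨p, hp0, hp1, hpx⟩ : ∃ p : {S : Finset β // S.card = d} → ℝ, (∀ S, 0 ≤ p S) ∧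
      ∑ S, p S = t - ε ∧ ∀ b, ∑ S, (if b ∈ S.1 then p S else 0) = x' b := by
    rcases ht'.eq_or_lt with hz | hpos
    · refine ⟨0, by simp, by simpa using hz, fun b => ?_⟩
      simpa using le_antisymm (hx0 b) (hz ▸ hx1 b)
    · refine ih _ ?_ x' (t - ε) ht' hx0 hx1 hxs rfl
      rw [← hk]
      -- The minimizer `b₀` lands on `0` or `t - ε`, and no new intermediate coordinate appears.
      refine Finset.card_lt_card (Finset.ssubset_iff_of_subset ?_ |>.mpr ⟨b₀, ?_, ?_⟩)
      · intro b hb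
        simp only [Finset.mem_filter, Finset.mem_univ, true_and, x'] at hb ⊢
        split_ifs at hb <;> constructor <;> linarith [hb.1, hb.2]
      · by_cases h : b₀ ∈ S
        · have : ε = x b₀ := by simp [hε, f, h]
          simp only [Finset.mem_filter, Finset.mem_univ, true_and]
          constructor <;> linarith
        · have : ε = t - x b₀ := by simp [hε, f, h]
          simp only [Finset.mem_filter, Finset.mem_univ, true_and]
          constructor <;> linarith
      · by_cases h : b₀ ∈ S
        · have : ε = x b₀ := by simp [hε, f, h]
          simp [x', h, this]
        · have : ε = t - x b₀ := by simp [hε, f, h]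
          simp [x', h, this]
  refine ⟨fun T => p T + if T = ⟨S, hS⟩ then ε else 0, fun T => ?_, ?_, fun b => ?_⟩
  · have := hp0 T
    dsimp only
    split_ifs <;> linarith
  · simp [Finset.sum_add_distrib, hp1]
  · have h2 : ∀ T : {S : Finset β // S.card = d},
        (if b ∈ T.1 then p T + (if T = ⟨S, hS⟩ then ε else 0) else 0)
        = (if b ∈ T.1 then p T else 0) + if T = ⟨S, hS⟩ then (if b ∈ S then ε else 0) else 0 := by
      intro T
      by_cases hT : T = ⟨S, hS⟩
      · subst hT
        split_ifs <;> simp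
      · simp [hT]
    simp only [h2, Finset.sum_add_distrib, hpx]
    simp [x']

/-! ### Weyl operators on a `d`-element set. -/

/-- Identify `S` with `ZMod d`: `π` consists of the translations and `χ` of the additive characters,
extended trivially off `S`. Distinct translations never agree on `S`, and distinct characters are
orthogonal. -/
theorem exists_weyl_system {β : Type*} [DecidableEq β] {d : ℕ} [NeZero d] (S : Finset β)
    (hS : S.card = d) : ∃ (π : ZMod d → Equiv.Perm β) (χ : ZMod d → β → ℂ),
      (∀ a b, π a b ∈ S ↔ b ∈ S) ∧ (∀ a a', ∀ b ∈ S, π a b = π a' b → a = a') ∧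
      (∀ c b, χ c b * star (χ c b) = 1) ∧
      ∀ c c', ∑ b ∈ S, χ c b * star (χ c' b) = if c = c' then (d : ℂ) else 0 := by
  have hcard : Fintype.card S = Fintype.card (ZMod d) := by simp [hS, ZMod.card]
  let g : S ≃ ZMod d := Fintype.equivOfCardEq hcard
  let π : ZMod d → Equiv.Perm β := fun a =>
    Equiv.Perm.ofSubtype (p := fun b => b ∈ S) ((g.trans (Equiv.addRight a)).trans g.symm)
  let χ : ZMod d → β → ℂ := fun c b => if h : b ∈ S then ZMod.stdAddChar (c * g ⟨b, h⟩) else 1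
  have hπ : ∀ a b (h : b ∈ S), π a b = (g.symm (g ⟨b, h⟩ + a) : S) := by
    intro a b h
    simp only [π]
    rw [Equiv.Perm.ofSubtype_apply_of_mem _ h]
    simp
  have hπ' : ∀ a b, b ∉ S → π a b = b := fun a b h =>
    Equiv.Perm.ofSubtype_apply_of_not_mem _ h
  have hstar : ∀ z : ZMod d, star (ZMod.stdAddChar z : ℂ) = ZMod.stdAddChar (-z) := by
    intro z
    rw [ZMod.stdAddChar_apply, ZMod.stdAddChar_apply, AddChar.map_neg_eq_inv, Circle.coe_inv_eq_conj]
    rfl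
  refine ⟨π, χ, fun a b => ?_, fun a a' b hb h => ?_, fun c b => ?_, fun c c' => ?_⟩
  · by_cases h : b ∈ S
    · simp [hπ a b h, h]
    · simp [hπ' a b h]
  · rw [hπ a b hb, hπ a' b hb] at h
    simpa using h
  · by_cases h : b ∈ S
    · simp only [χ, h, dite_true]
      rw [hstar, ← AddChar.map_add_eq_mul]
      simp
    · simp [χ, h]
  · rw [← Finset.sum_coe_sort]
    have h1 : ∀ b : S, χ c b * star (χ c' b) = ZMod.stdAddChar (g b * (c - c')) := by
      intro b
      simp only [χ, b.2, dite_true]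
      rw [hstar, ← AddChar.map_add_eq_mul]
      congr 1
      ring
    simp only [h1]
    rw [g.sum_comp (fun z => (ZMod.stdAddChar (z * (c - c')) : ℂ)),
      AddChar.sum_mulShift _ (ZMod.isPrimitive_stdAddChar d)]
    simp [sub_eq_zero, ZMod.card]

/-! ### Isometries controlled on the input. -/

theorem dephased_basisFun {n : ℕ} (ρ : Matrix (Fin n) (Fin n) ℂ) :
    dephased (EuclideanSpace.basisFun (Fin n) ℂ) ρ = Matrix.diagonal fun i => ρ i i := by
  have h : (EuclideanSpace.basisFun (Fin n) ℂ).columns = 1 := by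
    ext i j
    simp [OrthonormalBasis.columns, Matrix.one_apply]
  rw [dephased_eq_columns, h]
  simp

/-- The matrix acting as `|j⟩ ⊗ |b⟩ ↦ |j⟩ ⊗ ∑ w j k c b |k⟩ ⊗ |c⟩`. -/
def controlledMatrix {ι κ γ β : Type*} [DecidableEq ι] (w : ι → κ → γ → β → ℂ) :
    Matrix ((ι × κ) × γ) (ι × β) ℂ :=
  Matrix.of fun r s => if r.1.1 = s.1 then w s.1 r.1.2 r.2 s.2 else 0

theorem controlledMatrix_isometry {ι κ γ β : Type*} [Fintype ι] [Fintype κ] [Fintype γ]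
    [DecidableEq ι] [DecidableEq β] (w : ι → κ → γ → β → ℂ)
    (hw : ∀ i b b', ∑ k, ∑ c, star (w i k c b) * w i k c b' = if b = b' then 1 else 0) :
    (controlledMatrix w)ᴴ * controlledMatrix w = 1 := by
  ext ⟨i, b⟩ ⟨i', b'⟩
  simp only [Matrix.mul_apply, Matrix.conjTranspose_apply, controlledMatrix, Matrix.of_apply]
  rw [Fintype.sum_prod_type, Fintype.sum_prod_type, Finset.sum_eq_single i _ (by simp)]
  · by_cases h : i = i'
    · subst h
      simpa [Matrix.one_apply] using hw i b b'
    · simp [h]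
  · intro x _ hx
    simp [hx]

theorem controlledMatrix_conj_apply {ι κ γ β : Type*} [Fintype ι] [Fintype β] [DecidableEq ι]
    [DecidableEq β] (w : ι → κ → γ → β → ℂ) (ρ : Matrix ι ι ℂ) (l : β → ℂ) (i i' : ι) (k k' : κ)
    (c c' : γ) :
    (controlledMatrix w * (ρ ⊗ₖ Matrix.diagonal l) * (controlledMatrix w)ᴴ :
      Matrix ((ι × κ) × γ) ((ι × κ) × γ) ℂ) ((i, k), c) ((i', k'), c')
      = ρ i i' * ∑ b, l b * (w i k c b * star (w i' k' c' b)) := by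
  have h : ∀ x b, (controlledMatrix w * (ρ ⊗ₖ Matrix.diagonal l) : Matrix ((ι × κ) × γ) (ι × β) ℂ)
      ((i, k), c) (x, b) = w i k c b * (ρ i x * l b) := by
    intro x b
    rw [Matrix.mul_apply, Fintype.sum_prod_type, Finset.sum_eq_single i _ (by simp),
      Finset.sum_eq_single b _ (by simp)]
    · simp [controlledMatrix, Matrix.kroneckerMap_apply]
    · intro b' _ hb
      simp [Matrix.kroneckerMap_apply, Matrix.diagonal_apply_ne _ hb]
    · intro j _ hj
      simp [controlledMatrix, hj.symm]
  rw [Matrix.mul_apply, Fintype.sum_prod_type, Finset.sum_eq_single i' _ (by simp), Finset.mul_sum]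
  · refine Finset.sum_congr rfl fun b _ => ?_
    simp only [h, Matrix.conjTranspose_apply]
    simp [controlledMatrix]
    ring
  · intro j _ hj
    simp [controlledMatrix, hj.symm]

/-- The control contributes only the factor `ρ i i'`, so dephasing reduces to scalar identities for
`w`. The equivalences `f` and `g` permit structured index types in place of `Fin`. -/
theorem isDephasing_controlledMatrix {n : ℕ} {κ γ : Type*} [Fintype κ] [Fintype γ]
    [DecidableEq κ] (σ η τ : QState) (V : Matrix (Fin σ.dim) (Fin σ.dim) ℂ) (hV : Vᴴ * V = 1)
    (hV' : V * Vᴴ = 1) (l : Fin σ.dim → ℂ) (hσ : σ.mat = V * Matrix.diagonal l * Vᴴ)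
    (f : Fin η.dim ≃ κ) (p : κ → ℂ) (hη : η.mat = (Matrix.diagonal p).submatrix f f)
    (g : Fin τ.dim ≃ γ) (T : Matrix γ γ ℂ) (hτ : τ.mat = T.submatrix g g)
    (w : Fin n → κ → γ → Fin σ.dim → ℂ)
    (hiso : ∀ i b b', ∑ k, ∑ c, star (w i k c b) * w i k c b' = if b = b' then 1 else 0)
    (hout : ∀ i i' k k', ∑ c, ∑ b, l b * (w i k c b * star (w i' k' c b))
      = if i = i' ∧ k = k' then p k else 0)
    (hcomp : ∀ i c c', ∑ k, ∑ b, l b * (w i k c b * star (w i k c' b)) = T c c') :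
    DephasesInto n σ τ := by
  let w' : Fin n → Fin η.dim → Fin τ.dim → Fin σ.dim → ℂ := fun i k c b => w i (f k) (g c) b
  let W := controlledMatrix w'
  let Y : Matrix (Fin n × Fin σ.dim) (Fin n × Fin σ.dim) ℂ := (1 : Matrix (Fin n) (Fin n) ℂ) ⊗ₖ Vᴴ
  have hY : Yᴴ * Y = 1 := by
    rw [Matrix.conjTranspose_kronecker, ← Matrix.mul_kronecker_mul,
      Matrix.conjTranspose_conjTranspose, hV']
    simp
  have hW : Wᴴ * W = 1 := by
    refine controlledMatrix_isometry w' fun i b b' => ?_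
    rw [← hiso i b b']
    refine Fintype.sum_equiv f _ _ fun k => Fintype.sum_equiv g _ _ fun c => rfl
  have hM : ∀ ρ : Matrix (Fin n) (Fin n) ℂ, (W * Y) * (ρ ⊗ₖ σ.mat) * (W * Y)ᴴ
      = W * (ρ ⊗ₖ Matrix.diagonal l) * Wᴴ := by
    intro ρ
    have h : Y * (ρ ⊗ₖ σ.mat) * Yᴴ = ρ ⊗ₖ Matrix.diagonal l := by
      rw [Matrix.conjTranspose_kronecker, ← Matrix.mul_kronecker_mul, ← Matrix.mul_kronecker_mul,
        Matrix.conjTranspose_conjTranspose, hσ, conj_mul_mul_cancel hV]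
      simp
    rw [← h, Matrix.conjTranspose_mul]
    simp only [Matrix.mul_assoc]
  refine ⟨EuclideanSpace.basisFun (Fin n) ℂ, η, W * Y, ?_, fun ρ _ _ => ?_, fun ρ _ hρ => ?_⟩
  · rw [Matrix.conjTranspose_mul, Matrix.mul_assoc, ← Matrix.mul_assoc Wᴴ, hW, Matrix.one_mul, hY]
  · rw [hM, dephased_basisFun, hη]
    ext ⟨i, k⟩ ⟨i', k'⟩
    simp only [partialTraceRight, W, controlledMatrix_conj_apply]
    rw [← Finset.mul_sum]
    have h : ∑ c, ∑ b, l b * (w' i k c b * star (w' i' k' c b))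
        = if i = i' ∧ f k = f k' then p (f k) else 0 := by
      rw [← hout]
      exact Fintype.sum_equiv g _ _ fun c => rfl
    rw [h]
    by_cases h1 : i = i'
    · subst h1
      simp [Matrix.kroneckerMap_apply, Matrix.diagonal_apply]
    · simp [Matrix.kroneckerMap_apply, h1]
  · rw [hM, hτ]
    ext c c'
    simp only [partialTraceLeft, W, Fintype.sum_prod_type, controlledMatrix_conj_apply]
    have h : ∀ i, ∑ k, ∑ b, l b * (w' i k c b * star (w' i k c' b)) = T (g c) (g c') := by
      intro i
      rw [← hcomp i]
      exact Fintype.sum_equiv f _ _ fun k => rfl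
    simp only [← Finset.mul_sum, h]
    rw [← Finset.sum_mul]
    have : ∑ i, ρ i i = 1 := hρ
    rw [this, one_mul, Matrix.submatrix_apply]

/-! ### Diagonal states, operator norm and min-entropy. -/

/-- The state that is diagonal in the standard basis with the given eigenvalues. -/
noncomputable def QState.ofWeights {κ : Type*} [Fintype κ] (p : κ → ℝ) (h0 : ∀ k, 0 ≤ p k)
    (h1 : ∑ k, p k = 1) : QState where
  dim := Fintype.card κ
  mat := Matrix.diagonal fun i => (p ((Fintype.equivFin κ).symm i) : ℂ)
  posSemidef := Matrix.PosSemidef.diagonal fun i => by simpa using h0 _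
  trace_eq_one := by
    rw [Matrix.trace_diagonal, (Fintype.equivFin κ).symm.sum_comp (fun k => (p k : ℂ))]
    exact_mod_cast h1

theorem QState.ofWeights_mat {κ : Type*} [Fintype κ] [DecidableEq κ] (p : κ → ℝ)
    (h0 : ∀ k, 0 ≤ p k) (h1 : ∑ k, p k = 1) : (QState.ofWeights p h0 h1).mat =
      (Matrix.diagonal fun k => (p k : ℂ)).submatrix (Fintype.equivFin κ).symm
        (Fintype.equivFin κ).symm := by
  rw [Matrix.submatrix_diagonal_equiv]
  rfl

open scoped Matrix.Norms.L2Operator in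
theorem norm_toEuclideanCLM_diagonal {n : Type*} [Fintype n] [DecidableEq n] (v : n → ℂ) :
    ‖Matrix.toEuclideanCLM (n := n) (𝕜 := ℂ) (Matrix.diagonal v)‖ = ‖v‖ := by
  rw [Matrix.l2_opNorm_toEuclideanCLM, Matrix.l2_opNorm_diagonal]

theorem QState.norm_ofWeights_le {κ : Type*} [Fintype κ] (p : κ → ℝ)
    (h0 : ∀ k, 0 ≤ p k) (h1 : ∑ k, p k = 1) {r : ℝ} (hr : 0 ≤ r) (hp : ∀ k, p k ≤ r) :
    ‖Matrix.toEuclideanCLM (n := Fin (QState.ofWeights p h0 h1).dim) (𝕜 := ℂ)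
      (QState.ofWeights p h0 h1).mat‖ ≤ r := by
  refine (norm_toEuclideanCLM_diagonal _).trans_le ((pi_norm_le_iff_of_nonneg hr).mpr fun i => ?_)
  rw [Complex.norm_real, Real.norm_of_nonneg (h0 _)]
  exact hp _

theorem QState.eigenvalues_le_norm (σ : QState) (b : Fin σ.dim) :
    σ.posSemidef.isHermitian.eigenvalues b
      ≤ ‖Matrix.toEuclideanCLM (n := Fin σ.dim) (𝕜 := ℂ) σ.mat‖ := by
  have h := (Matrix.toEuclideanCLM (n := Fin σ.dim) (𝕜 := ℂ) σ.mat).le_opNorm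
    (σ.posSemidef.isHermitian.eigenvectorBasis b)
  have h2 : Matrix.toEuclideanCLM (n := Fin σ.dim) (𝕜 := ℂ) σ.mat
      (σ.posSemidef.isHermitian.eigenvectorBasis b)
      = (σ.posSemidef.isHermitian.eigenvalues b : ℂ) •
        σ.posSemidef.isHermitian.eigenvectorBasis b := by
    ext i
    have := congrFun (σ.posSemidef.isHermitian.mulVec_eigenvectorBasis b) i
    simpa using this
  rw [h2, norm_smul, OrthonormalBasis.norm_eq_one, mul_one, mul_one, Complex.norm_real,
    Real.norm_of_nonneg (σ.posSemidef.eigenvalues_nonneg b)] at h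
  exact h

open scoped Matrix.Norms.L2Operator in
theorem QState.norm_le_of_eigenvalues_le (σ : QState) {r : ℝ} (hr : 0 ≤ r)
    (h : ∀ b, σ.posSemidef.isHermitian.eigenvalues b ≤ r) :
    ‖Matrix.toEuclideanCLM (n := Fin σ.dim) (𝕜 := ℂ) σ.mat‖ ≤ r := by
  rw [Matrix.l2_opNorm_toEuclideanCLM]
  rw [σ.posSemidef.isHermitian.spectral_theorem, Unitary.conjStarAlgAut_apply, ← Unitary.coe_star,
    CStarRing.norm_mul_coe_unitary, CStarRing.norm_coe_unitary_mul, Matrix.l2_opNorm_diagonal]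
  refine (pi_norm_le_iff_of_nonneg hr).mpr fun b => ?_
  simpa [abs_of_nonneg (σ.posSemidef.eigenvalues_nonneg b)] using h b

theorem QState.norm_pos (σ : QState) :
    0 < ‖Matrix.toEuclideanCLM (n := Fin σ.dim) (𝕜 := ℂ) σ.mat‖ := by
  refine norm_pos_iff.mpr fun h => ?_
  have h2 : σ.mat = 0 := (map_eq_zero_iff _ (Matrix.toEuclideanCLM (n := Fin σ.dim)
    (𝕜 := ℂ)).injective).mp h
  have := σ.trace_eq_one
  simp [h2] at this

theorem QState.logb_le_minEntropy_iff (σ : QState) {d : ℕ} (hd : 1 ≤ d) :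
    Real.logb 2 (d : ℝ) ≤ σ.minEntropy ↔
      ‖Matrix.toEuclideanCLM (n := Fin σ.dim) (𝕜 := ℂ) σ.mat‖ ≤ (d : ℝ)⁻¹ := by
  have hd' : (0 : ℝ) < d := by exact_mod_cast hd
  rw [QState.minEntropy, le_neg, ← Real.logb_inv]
  exact Real.logb_le_logb (by norm_num) σ.norm_pos (inv_pos.mpr hd')

/-! ### Construction of a dephasing step that keeps the norm bound. -/

theorem exists_conditional_weights {β κ : Type*} [Fintype κ] [Nonempty κ] (l : β → ℝ)
    (hl : ∀ b, 0 ≤ l b) (m : β → κ → ℝ) (hm : ∀ b k, 0 ≤ m b k) (hs : ∀ b, ∑ k, m b k = l b) :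
    ∃ q : β → κ → ℝ, (∀ b k, 0 ≤ q b k) ∧ (∀ b, ∑ k, q b k = 1) ∧ ∀ b k, l b * q b k = m b k := by
  classical
  -- A point mass where `l b = 0` keeps `q b` normalized, as the isometry requires even on the
  -- kernel of `σ`.
  refine ⟨fun b k => if l b = 0 then (if k = Classical.arbitrary κ then 1 else 0) else m b k / l b,
    fun b k => ?_, fun b => ?_, fun b k => ?_⟩
  · dsimp only
    split_ifs
    · exact zero_le_one
    · exact le_rfl
    · exact div_nonneg (hm b k) (hl b)
  · by_cases h : l b = 0
    · simp [h]
    · simp [h, ← Finset.sum_div, hs]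
  · by_cases h : l b = 0
    · have := (Finset.sum_eq_zero_iff_of_nonneg fun k _ => hm b k).mp ((hs b).trans h) k
        (Finset.mem_univ _)
      simp [h, this]
    · simp only [h, if_false]
      field_simp

theorem QState.exists_dephasesInto (σ : QState) {d : ℕ} (hd : 1 ≤ d)
    (hσ : ‖Matrix.toEuclideanCLM (n := Fin σ.dim) (𝕜 := ℂ) σ.mat‖ ≤ (d : ℝ)⁻¹) :
    ∃ τ : QState, ‖Matrix.toEuclideanCLM (n := Fin τ.dim) (𝕜 := ℂ) τ.mat‖ ≤ (d : ℝ)⁻¹ ∧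
      DephasesInto (d ^ 2) σ τ := by
  classical
  have hd' : (0 : ℝ) < d := by exact_mod_cast hd
  have : NeZero d := ⟨by omega⟩
  obtain ⟨V, hV, hV', hdiag⟩ := σ.exists_diagonalization
  have hl0 := σ.posSemidef.eigenvalues_nonneg
  have hl1 := eigenvalues_sum_eq_one σ
  have hle := fun b => (σ.eigenvalues_le_norm b).trans hσ
  set l := σ.posSemidef.isHermitian.eigenvalues with hl
  obtain ⟨p, hp0, hp1, hpl⟩ := exists_weights_card_eq d hd (fun b => d * l b) 1 zero_le_one
    (fun b => mul_nonneg hd'.le (hl0 b))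
    (fun b => by
      have := mul_le_mul_of_nonneg_left (hle b) hd'.le
      rwa [mul_inv_cancel₀ hd'.ne'] at this)
    (by rw [← Finset.mul_sum, hl1])
  let κ := {S : Finset (Fin σ.dim) // S.card = d}
  -- Joint law of `S`, drawn with probability `p S`, and a uniform element `b` of `S`; its second
  -- marginal is the spectrum of `σ`.
  let m : Fin σ.dim → κ → ℝ := fun b S => if b ∈ S.1 then p S / d else 0
  have hm0 : ∀ b S, 0 ≤ m b S := fun b S => by
    simp only [m]
    split_ifs
    · exact div_nonneg (hp0 S) hd'.le
    · exact le_rfl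
  have hmb : ∀ b, ∑ S, m b S = l b := by
    intro b
    have h : ∀ S : κ, m b S = (if b ∈ S.1 then p S else 0) / d := fun S => by
      simp only [m]
      split_ifs <;> simp
    simp only [h, ← Finset.sum_div]
    rw [hpl b]
    field_simp
  have hmS : ∀ S : κ, ∑ b, m b S = p S := by
    intro S
    simp only [m, Finset.sum_ite_mem, Finset.univ_inter, Finset.sum_const, S.2, nsmul_eq_mul]
    field_simp
  have : Nonempty κ := by
    by_contra h
    rw [not_nonempty_iff] at h
    have : ∑ S : κ, p S = 0 := Finset.sum_of_isEmpty _
    rw [hp1] at this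
    exact one_ne_zero this
  obtain ⟨q, hq0, hq1, hql⟩ := exists_conditional_weights l hl0 m hm0 hmb
  choose π χ hπS hπ hχ hχχ using fun S : κ => exists_weyl_system S.1 S.2
  have hcard : Fintype.card (Fin (d ^ 2)) = Fintype.card (ZMod d × ZMod d) := by
    simp [ZMod.card, pow_two]
  let φ : Fin (d ^ 2) ≃ ZMod d × ZMod d := Fintype.equivOfCardEq hcard
  -- `|b⟩ ↦ ∑ √q(S|b) |S⟩ ⊗ |S, Wᵢ b⟩`, with `Wᵢ` the Weyl unitary on `S` labelled by `φ i`. The two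
  -- copies of `S` suppress coherence between different sets in either marginal.
  let w : Fin (d ^ 2) → κ → κ × Fin σ.dim → Fin σ.dim → ℂ := fun i S c b =>
    if S = c.1 ∧ c.2 = π S (φ i).1 b then ((Real.sqrt (q b S) : ℝ) : ℂ) * χ S (φ i).2 b else 0
  have hsqrt : ∀ b S, ((Real.sqrt (q b S) : ℝ) : ℂ) * ((Real.sqrt (q b S) : ℝ) : ℂ) = (q b S : ℂ) :=
    fun b S => by rw [← Complex.ofReal_mul, Real.mul_self_sqrt (hq0 b S)]
  have hww : ∀ i i' S b, (l b : ℂ) * ((((Real.sqrt (q b S) : ℝ) : ℂ) * χ S (φ i).2 b) *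
      star (((Real.sqrt (q b S) : ℝ) : ℂ) * χ S (φ i').2 b))
      = (m b S : ℂ) * (χ S (φ i).2 b * star (χ S (φ i').2 b)) := by
    intro i i' S b
    rw [← hql b S, Complex.ofReal_mul, ← hsqrt b S]
    simp
    ring
  have hτ0 : ∀ c : κ × Fin σ.dim, 0 ≤ m c.2 c.1 := fun c => hm0 _ _
  have hτ1 : ∑ c : κ × Fin σ.dim, m c.2 c.1 = 1 := by
    rw [Fintype.sum_prod_type]
    simp only [hmS]
    exact hp1
  refine ⟨QState.ofWeights (fun c : κ × Fin σ.dim => m c.2 c.1) hτ0 hτ1,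
    QState.norm_ofWeights_le _ hτ0 hτ1 (inv_nonneg.mpr hd'.le) fun c => ?_,
    isDephasing_controlledMatrix σ (QState.ofWeights p hp0 hp1) _ V hV hV' _ hdiag
      (Fintype.equivFin κ).symm _ (QState.ofWeights_mat p hp0 hp1)
      (Fintype.equivFin (κ × Fin σ.dim)).symm _ (QState.ofWeights_mat _ hτ0 hτ1) w ?_ ?_ ?_⟩
  · have h : p c.1 ≤ 1 := hp1 ▸ Finset.single_le_sum (fun S _ => hp0 S) (Finset.mem_univ _)
    simp only [m]
    split_ifs
    · rw [div_eq_mul_inv]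
      exact mul_le_of_le_one_left (inv_nonneg.mpr hd'.le) h
    · exact inv_nonneg.mpr hd'.le
  · intro i b b'
    have h : ∀ S : κ, ∑ c, star (w i S c b) * w i S c b' = if b = b' then (q b S : ℂ) else 0 := by
      intro S
      rw [Fintype.sum_prod_type, Finset.sum_eq_single S _ (by simp)]
      · rw [Finset.sum_eq_single (π S (φ i).1 b) _ (by simp)]
        · by_cases hb : b = b'
          · subst hb
            have h1 := hχ S (φ i).2 b
            simp only [w, and_self, if_true, star_mul']
            rw [← hsqrt b S]
            calc _ = ((Real.sqrt (q b S) : ℝ) : ℂ) * ((Real.sqrt (q b S) : ℝ) : ℂ) *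
                  (χ S (φ i).2 b * star (χ S (φ i).2 b)) := by
                  simp
                  ring
              _ = _ := by rw [h1, mul_one]
          · simp [w, hb]
        · intro x _ hx
          simp [w, hx]
      · intro S' _ hS'
        simp [w, hS'.symm]
    simp only [h]
    by_cases hb : b = b'
    · simp only [hb, if_true]
      exact_mod_cast hq1 b'
    · simp [hb]
  · intro i i' S S'
    by_cases hS : S = S'
    · subst hS
      rw [Fintype.sum_prod_type, Finset.sum_eq_single S _ (by simp)]
      · have h : ∀ b, ∑ x, (l b : ℂ) * (w i S (S, x) b * star (w i' S (S, x) b))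
            = if π S (φ i).1 b = π S (φ i').1 b then
              (m b S : ℂ) * (χ S (φ i).2 b * star (χ S (φ i').2 b)) else 0 := by
          intro b
          rw [Finset.sum_eq_single (π S (φ i).1 b) _ (by simp)]
          · by_cases hb : π S (φ i).1 b = π S (φ i').1 b
            · rw [if_pos hb, ← hww]
              simp only [w, hb, and_self, if_true]
            · simp [w, hb]
          · intro x _ hx
            simp [w, hx]
        rw [Finset.sum_comm]
        simp only [h]
        have h2 : ∀ b, (if π S (φ i).1 b = π S (φ i').1 b then
            (m b S : ℂ) * (χ S (φ i).2 b * star (χ S (φ i').2 b)) else 0)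
            = if b ∈ S.1 then (if (φ i).1 = (φ i').1 then
              (p S / d : ℂ) * (χ S (φ i).2 b * star (χ S (φ i').2 b)) else 0) else 0 := by
          intro b
          by_cases hb : b ∈ S.1
          · have h3 : π S (φ i).1 b = π S (φ i').1 b ↔ (φ i).1 = (φ i').1 :=
              ⟨hπ S _ _ b hb, fun h => by rw [h]⟩
            simp [h3, hb, m]
          · simp [hb, m]
        simp only [h2, Finset.sum_ite_mem, Finset.univ_inter]
        by_cases ha : (φ i).1 = (φ i').1
        · simp only [ha, if_true, ← Finset.mul_sum, hχχ]
          have h4 : (φ i).2 = (φ i').2 ↔ i = i' :=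
            ⟨fun h => φ.injective (Prod.ext ha h), fun h => by rw [h]⟩
          simp only [h4]
          have hdc : (d : ℂ) ≠ 0 := by exact_mod_cast hd'.ne'
          by_cases hi : i = i'
          · simp [hi, hdc]
          · simp [hi]
        · have hi : i ≠ i' := fun h => ha (by rw [h])
          simp [ha, hi]
      · intro S' _ hS'
        simp [w, hS'.symm]
    · rw [if_neg fun h => hS h.2]
      refine Finset.sum_eq_zero fun c _ => Finset.sum_eq_zero fun b _ => ?_
      by_cases h1 : S = c.1
      · have h2 : S' ≠ c.1 := fun h => hS (h1.trans h.symm)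
        simp [w, h2]
      · simp [w, h1]
  · intro i c c'
    rw [Finset.sum_eq_single c.1 _ (by simp)]
    · rw [Finset.sum_eq_single ((π c.1 (φ i).1).symm c.2) _ (by simp)]
      · by_cases hc : c = c'
        · subst hc
          -- `m · S` is constant on `S` and zero off it, and `π` preserves `S`; hence the residual
          -- state does not depend on `i`.
          have h1 : m ((π c.1 (φ i).1).symm c.2) c.1 = m c.2 c.1 := by
            have := hπS c.1 (φ i).1 ((π c.1 (φ i).1).symm c.2)
            rw [Equiv.apply_symm_apply] at this
            simp only [m, this]
          simp only [w, Equiv.apply_symm_apply, and_self, if_true, hww, hχ, h1]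
          simp
        · rw [Matrix.diagonal_apply_ne _ hc]
          have : ¬ (c.1 = c'.1 ∧ c'.2 = c.2) := fun h => hc (Prod.ext h.1 h.2.symm)
          simp only [w, Equiv.apply_symm_apply, this, if_false]
          simp
      · intro b _ hb
        have : ¬ (c.2 = π c.1 (φ i).1 b) := fun h => hb (by rw [h, Equiv.symm_apply_apply])
        simp [w, this]
    · intro S _ hS
      simp [w, hS]

/-! ### The equivalence. -/

theorem theorem2 (d : ℕ) (hd : 1 ≤ d) (σ : QState) :
    CatalyticallyDephases (d ^ 2) σ ↔ Real.logb 2 (d : ℝ) ≤ σ.minEntropy := by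
  have hd' : (0 : ℝ) < d := by exact_mod_cast hd
  rw [σ.logb_le_minEntropy_iff hd]
  constructor
  · rintro ⟨s, rfl, hs⟩
    refine (s 0).norm_le_of_eigenvalues_le (inv_nonneg.mpr hd'.le) fun b => ?_
    have h := (hs 0).mul_sq_eigenvalues_le_one b
    rw [Nat.cast_pow, ← mul_pow] at h
    have h2 : (d : ℝ) * (s 0).posSemidef.isHermitian.eigenvalues b ≤ 1 :=
      le_of_abs_le (by simpa using (sq_le_one_iff_abs_le_one _).mp h)
    rwa [← mul_le_mul_iff_right₀ hd', mul_inv_cancel₀ hd'.ne']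
  · intro hσ
    -- Bundling the norm bound with the state turns one step into a self-map, whose iterates are the
    -- required sequence.
    let Q := {σ : QState // ‖Matrix.toEuclideanCLM (n := Fin σ.dim) (𝕜 := ℂ) σ.mat‖ ≤ (d : ℝ)⁻¹}
    choose f hf hfd using fun σ : Q => σ.1.exists_dephasesInto hd σ.2
    let s : ℕ → Q := fun k => (fun σ => ⟨f σ, hf σ⟩)^[k] ⟨σ, hσ⟩
    refine ⟨fun k => (s k).1, rfl, fun k => ?_⟩
    have h : s (k + 1) = ⟨f (s k), hf (s k)⟩ := Function.iterate_succ_apply' _ _ _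
    dsimp only
    rw [h]
    exact hfd (s k)
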